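/- Let $N\ge 2$, let $t_1<\dots<t_N$ be real numbers, and let $p,q$ be real polynomials without common real zeros such that the real zeros of $p$ are exactly $t_1,\dots,t_N$, $p'(t_j)\neq 0$ for $j=1,\dots,N$, and $q$ has at most one zero in $]t_j,t_{j+1}[$ for each $j=1,\dots,N-1$. Let $L=p(t)\partial_t+q(t)\partial_x$ act on the space $C^\infty(\mathbb{R}^2)$ of (real- or complex-valued) smooth functions of $(t,x)$. For $j\in\{1,\dots,N-1\}$ call the strip $S_j=\,]t_j,t_{j+1}[\,\times\mathbb{R}$ a separatrix for $L$ if for every $(\tau,y)\in S_j$ the characteristic curve $x(t)=x(t;\tau,y)$, i.e. the solution on $]t_j,t_{j+1}[$ of $\dot x(t)=q(t)/p(t)$, $x(\tau)=y$, satisfies either $\lim_{t\to t_j^+}x(t)=\lim_{t\to t_{j+1}^-}x(t)=+\infty$ or $\lim_{t\to t_j^+}x(t)=\lim_{t\to t_{j+1}^-}x(t)=-\infty$. Then the following assertions are equivalent: (i) $L$ is not surjective in $C^\infty(\mathbb{R}^2)$, i.e. there is $f\in C^\infty(\mathbb{R}^2)$ such that $Lu=f$ has no solution $u\in C^\infty(\mathbb{R}^2)$;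 (ii) $S_j$ is a separatrix for $L$ for some $j\in\{1,\dots,N-1\}$; (iii) there exist $j\in\{1,\dots,N-1\}$ and $\theta_j\in\,]t_j,t_{j+1}[$ such that $q(\theta_j)=0$ and $q$ has opposite (strict) signs in $]t_j,\theta_j[$ and $]\theta_j,t_{j+1}[$. In particular, for every real $\lambda\neq 0$ and every integer $k\ge 0$, the operator $L_{\lambda,k}=(1-t^2)\partial_t+\lambda t^k\partial_x$ is not surjective in $C^\infty(\mathbb{R}^2)$ if and only if $k$ is odd. -/

import Mathlib

open Filter Topology Set Polynomial
open scoped ContDiff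

/-- The operator `L u = p(t) ∂ₜ u + q(t) ∂ₓ u`, acting on functions of `(t, x) ∈ ℝ × ℝ`. -/
noncomputable def planeField {𝕜 : Type*} [RCLike 𝕜] (p q : ℝ[X]) (u : ℝ × ℝ → 𝕜) :
    ℝ × ℝ → 𝕜 :=
  fun z => p.eval z.1 • fderiv ℝ u z (1, 0) + q.eval z.1 • fderiv ℝ u z (0, 1)

/-- The space `C^∞(ℝ²)` of smooth `𝕜`-valued functions (`𝕜` is `ℝ` or `ℂ`). -/
def smoothPlane (𝕜 : Type*) [RCLike 𝕜] : Set (ℝ × ℝ → 𝕜) :=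
  {u | ContDiff ℝ ∞ u}

/-- `L` is surjective in `C^∞(ℝ²)`: every smooth `f` is `L u` for some smooth `u`. -/
def SurjectiveOnSmooth (𝕜 : Type*) [RCLike 𝕜] (p q : ℝ[X]) : Prop :=
  SurjOn (planeField p q) (smoothPlane 𝕜) (smoothPlane 𝕜)

/-- `x` is the characteristic curve `x = x(t; τ, y)` of `L` in the strip `]a, b[ × ℝ`
(on which `p` has no zeros): `dx/dt = q/p` on `]a, b[` and `x(τ) = y`. -/
def IsCharacteristic (p q : ℝ[X]) (a b τ y : ℝ) (x : ℝ → ℝ) : Prop :=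
  (∀ t ∈ Ioo a b, HasDerivAt x (q.eval t / p.eval t) t) ∧ x τ = y

/-- The strip `]a, b[ × ℝ` is a separatrix for `L`. -/
def IsSeparatrix (p q : ℝ[X]) (a b : ℝ) : Prop :=
  ∀ τ ∈ Ioo a b, ∀ y : ℝ, ∀ x : ℝ → ℝ, IsCharacteristic p q a b τ y x →
    (Tendsto x (𝓝[>] a) atTop ∧ Tendsto x (𝓝[<] b) atTop) ∨
    (Tendsto x (𝓝[>] a) atBot ∧ Tendsto x (𝓝[<] b) atBot)

/-- `f` has opposite signs in `]a, θ[` and `]θ, b[`. -/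
def OppositeSigns (f : ℝ → ℝ) (a θ b : ℝ) : Prop :=
  ((∀ s ∈ Ioo a θ, 0 < f s) ∧ (∀ s ∈ Ioo θ b, f s < 0)) ∨
  ((∀ s ∈ Ioo a θ, f s < 0) ∧ (∀ s ∈ Ioo θ b, 0 < f s))

/-! Everything depends on the signs of `q` at the zeros of `p`, where it does not vanish. If these
signs agree, say positive, put `ψ = √(p² + q²)`. A shear `x ↦ x + h t` turns `L` into `p ∂ₜ + ψ ∂ₓ`;
division by `ψ` leaves `a ∂ₜ + ∂ₓ` with `|a| ≤ 1`. The field `a` has a complete smooth flow with `x`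
as time, and integration along it from `x = 0` solves the equation
(`exists_solution_of_pos_at_zeros`). If the signs differ at two consecutive zeros, so do those of
`p'`, and the residues `q / p'` of `q / p` have the same sign. Characteristics thus go
logarithmically to the same infinity at both ends: the strip is a separatrix
(`isSeparatrix_of_mul_neg`). In a separatrix, translates of one characteristic meet the axis `x = 0`
at two points arbitrarily near the two ends. A solution of `L u = 1` changes between them by the
travel time `∫ dt / p`, which is unbounded, while `u` is bounded on the compact segment of the axis
(`not_surjectiveOnSmooth_of_isSeparatrix`). -/

/-! ### Smoothness of integrals depending on a parameter. -/

section ParametricIntegrals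

variable {E : Type*} [NormedAddCommGroup E] [NormedSpace ℝ E]

/-- A function on the plane with continuous partial derivatives is differentiable. -/
theorem hasFDerivAt_of_continuous_partials {G G₁ G₂ : ℝ × ℝ → E}
    (h₁ : ∀ x y, HasDerivAt (fun r => G (r, y)) (G₁ (x, y)) x)
    (h₂ : ∀ x y, HasDerivAt (fun r => G (x, r)) (G₂ (x, y)) y)
    (c₁ : Continuous G₁) (c₂ : Continuous G₂) (z : ℝ × ℝ) :
    HasFDerivAt G ((ContinuousLinearMap.toSpanSingleton ℝ (G₁ z)).coprod
      (ContinuousLinearMap.toSpanSingleton ℝ (G₂ z))) z := by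
  have key := hasStrictFDerivAt_uncurry_coprod (𝕜 := ℝ) (u := z) (f := fun x y => G (x, y))
    (f₁ := fun x y => ContinuousLinearMap.toSpanSingleton ℝ (G₁ (x, y)))
    (f₂ := fun x y => ContinuousLinearMap.toSpanSingleton ℝ (G₂ (x, y)))
    (Eventually.of_forall fun v => (h₁ v.1 v.2).hasFDerivAt)
    (Eventually.of_forall fun v => (h₂ v.1 v.2).hasFDerivAt)
    (((ContinuousLinearMap.toSpanSingletonCLE (𝕜 := ℝ) (E := E)).continuous.comp c₁).continuousAt)
    (((ContinuousLinearMap.toSpanSingletonCLE (𝕜 := ℝ) (E := E)).continuous.comp c₂).continuousAt)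
  exact key.hasFDerivAt

/-- A function on the plane whose partial derivatives are `C^n` is `C^(n+1)`. -/
theorem contDiff_succ_of_partials {n : ℕ} {G G₁ G₂ : ℝ × ℝ → E}
    (h₁ : ∀ x y, HasDerivAt (fun r => G (r, y)) (G₁ (x, y)) x)
    (h₂ : ∀ x y, HasDerivAt (fun r => G (x, r)) (G₂ (x, y)) y)
    (c₁ : ContDiff ℝ n G₁) (c₂ : ContDiff ℝ n G₂) : ContDiff ℝ (n + 1 : ℕ) G := by
  rw [Nat.cast_add, Nat.cast_one, contDiff_succ_iff_hasFDerivAt]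
  refine ⟨_, ?_, hasFDerivAt_of_continuous_partials h₁ h₂ c₁.continuous c₂.continuous⟩
  have e₁ := (ContinuousLinearMap.toSpanSingletonCLE (𝕜 := ℝ) (E := E)).contDiff.comp c₁
  have e₂ := (ContinuousLinearMap.toSpanSingletonCLE (𝕜 := ℝ) (E := E)).contDiff.comp c₂
  exact (ContinuousLinearMap.coprodEquivL ℝ (E := ℝ) (F := ℝ) (G := E)).contDiff.comp (e₁.prodMk e₂)

/-- Differentiation under the integral sign over a compact interval. -/
theorem hasDerivAt_integral_of_continuous_deriv {H H₂ : ℝ × ℝ → E}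
    (cH : Continuous H) (h₂ : ∀ x y, HasDerivAt (fun r => H (x, r)) (H₂ (x, y)) y)
    (c₂ : Continuous H₂) (b y : ℝ) :
    HasDerivAt (fun y => ∫ r in (0 : ℝ)..b, H (r, y)) (∫ r in (0 : ℝ)..b, H₂ (r, y)) y := by
  obtain ⟨C, hC⟩ := (isCompact_uIcc.prod (isCompact_closedBall y 1)).exists_bound_of_continuousOn
    (s := uIcc 0 b ×ˢ Metric.closedBall y 1) c₂.continuousOn
  refine (intervalIntegral.hasDerivAt_integral_of_dominated_loc_of_deriv_le
    (F := fun y r => H (r, y)) (F' := fun y r => H₂ (r, y)) (bound := fun _ => C)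
    (Metric.closedBall_mem_nhds y one_pos) (Eventually.of_forall fun x => ?_) ?_ ?_
    (Eventually.of_forall fun r hr x hx => hC (r, x) ⟨uIoc_subset_uIcc hr, hx⟩)
    (by simp) (Eventually.of_forall fun r _ x _ => h₂ r x)).2
  · exact (cH.comp (by fun_prop)).aestronglyMeasurable
  · exact (cH.comp (by fun_prop)).intervalIntegrable _ _
  · exact (c₂.comp (by fun_prop)).aestronglyMeasurable

theorem ContDiff.hasDerivAt_snd {H : ℝ × ℝ → E} (hH : ContDiff ℝ 1 H) (x y : ℝ) :
    HasDerivAt (fun r => H (x, r)) (fderiv ℝ H (x, y) (0, 1)) y := by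
  have := (hH.differentiable (by norm_num) (x, y)).hasFDerivAt.comp_hasDerivAt y
    ((hasDerivAt_const y x).prodMk (hasDerivAt_id y))
  exact this

theorem ContDiff.hasDerivAt_fst {H : ℝ × ℝ → E} (hH : ContDiff ℝ 1 H) (x y : ℝ) :
    HasDerivAt (fun r => H (r, y)) (fderiv ℝ H (x, y) (1, 0)) x := by
  have := (hH.differentiable (by norm_num) (x, y)).hasFDerivAt.comp_hasDerivAt x
    ((hasDerivAt_id x).prodMk (hasDerivAt_const x y))
  exact this

/-- The primitive of a `C^n` function with respect to its first variable is `C^n`. -/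
theorem contDiff_primitive [CompleteSpace E] (n : ℕ) {H : ℝ × ℝ → E} (hH : ContDiff ℝ n H) :
    ContDiff ℝ n (fun z : ℝ × ℝ => ∫ r in (0 : ℝ)..z.1, H (r, z.2)) := by
  induction n generalizing H with
  | zero =>
    rw [Nat.cast_zero, contDiff_zero] at hH ⊢
    exact intervalIntegral.continuous_parametric_intervalIntegral_of_continuous
      (f := fun (z : ℝ × ℝ) r => H (r, z.2)) (by fun_prop) continuous_fst
  | succ n ih =>
    -- The first partial is `H` itself; the second is the primitive of `∂₂H`, covered by the
    -- induction hypothesis.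
    have h1 : ContDiff ℝ 1 H := hH.of_le (by exact_mod_cast Nat.le_add_left 1 n)
    have hD : ContDiff ℝ n fun z => fderiv ℝ H z (0, 1) :=
      (hH.fderiv_right (m := n) (by norm_cast)).clm_apply contDiff_const
    refine contDiff_succ_of_partials (G₁ := H) (fun x y => ?_)
      (fun x y => hasDerivAt_integral_of_continuous_deriv h1.continuous h1.hasDerivAt_snd
        hD.continuous x y) (hH.of_le (by exact_mod_cast Nat.le_succ n)) (ih hD)
    have c : Continuous fun r => H (r, y) := h1.continuous.comp (by fun_prop)
    exact intervalIntegral.integral_hasDerivAt_right (c.intervalIntegrable _ _)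
      (c.stronglyMeasurableAtFilter _ _) c.continuousAt

end ParametricIntegrals

/-! ### Global smooth flow of a bounded field on the line. -/

section Flow

/-- The mean value of `a'` over the segment between the two points. -/
noncomputable def meanDeriv (a : ℝ → ℝ) (z : ℝ × ℝ) : ℝ :=
  ∫ σ in (0 : ℝ)..1, deriv a (z.1 + σ * (z.2 - z.1))

theorem continuous_meanDeriv {a : ℝ → ℝ} (ha : ContDiff ℝ 1 a) : Continuous (meanDeriv a) := by
  have := ha.continuous_deriv le_rfl
  exact intervalIntegral.continuous_parametric_intervalIntegral_of_continuous
      (f := fun (z : ℝ × ℝ) σ => deriv a (z.1 + σ * (z.2 - z.1))) (by fun_prop) continuous_const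

theorem meanDeriv_self (a : ℝ → ℝ) (x : ℝ) : meanDeriv a (x, x) = deriv a x := by
  simp [meanDeriv]

theorem sub_eq_meanDeriv_mul {a : ℝ → ℝ} (ha : ContDiff ℝ 1 a) (x y : ℝ) :
    a y - a x = meanDeriv a (x, y) * (y - x) := by
  have c := ha.continuous_deriv le_rfl
  have h : ∀ σ ∈ uIcc (0 : ℝ) 1, HasDerivAt (fun σ => a (x + σ * (y - x)))
      (deriv a (x + σ * (y - x)) * (y - x)) σ := fun σ _ => by
    have h1 : HasDerivAt (fun σ : ℝ => x + σ * (y - x)) (y - x) σ := by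
      simpa using ((hasDerivAt_id σ).mul_const (y - x)).const_add x
    exact ((ha.differentiable (by norm_num) _).hasDerivAt).comp σ h1
  have := intervalIntegral.integral_eq_sub_of_hasDerivAt h
    (Continuous.intervalIntegrable (by fun_prop) _ _)
  rw [intervalIntegral.integral_mul_const] at this
  simpa [meanDeriv] using this.symm

/-- The difference of two integral curves of a `C^1` field on the line. -/
theorem integralCurve_sub_eq {a : ℝ → ℝ} (ha : ContDiff ℝ 1 a) {γ δ : ℝ → ℝ}
    (hγ : ∀ s, HasDerivAt γ (a (γ s)) s) (hδ : ∀ s, HasDerivAt δ (a (δ s)) s) (s : ℝ) :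
    δ s - γ s = (δ 0 - γ 0) * Real.exp (∫ r in (0 : ℝ)..s, meanDeriv a (γ r, δ r)) := by
  have cγ : Continuous γ := continuous_iff_continuousAt.2 fun s => (hγ s).continuousAt
  have cδ : Continuous δ := continuous_iff_continuousAt.2 fun s => (hδ s).continuousAt
  have cA : Continuous fun r => meanDeriv a (γ r, δ r) :=
    (continuous_meanDeriv ha).comp (cγ.prodMk cδ)
  set I : ℝ → ℝ := fun s => ∫ r in (0 : ℝ)..s, meanDeriv a (γ r, δ r)
  have hI : ∀ s, HasDerivAt I (meanDeriv a (γ s, δ s)) s := fun s =>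
    intervalIntegral.integral_hasDerivAt_right (cA.intervalIntegrable _ _)
      (cA.stronglyMeasurableAtFilter _ _) cA.continuousAt
  -- The difference solves the linear equation `w' = meanDeriv a (γ, δ) * w`; `exp (-I)` is its
  -- integrating factor.
  have hW : ∀ s, HasDerivAt (fun s => (δ s - γ s) * Real.exp (-I s)) 0 s := fun s => by
    refine (((hδ s).sub (hγ s)).mul (hI s).neg.exp).congr_deriv ?_
    rw [sub_eq_meanDeriv_mul ha]
    simp only [Pi.sub_apply, Pi.neg_apply]
    ring
  have := is_const_of_deriv_eq_zero (fun s => (hW s).differentiableAt) (fun s => (hW s).deriv) s 0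
  have hI0 : I 0 = 0 := by simp [I]
  simp only [hI0, neg_zero, Real.exp_zero, mul_one] at this
  rw [← this, mul_assoc, ← Real.exp_add, neg_add_cancel, Real.exp_zero, mul_one]

theorem integralCurve_unique {a : ℝ → ℝ} (ha : ContDiff ℝ 1 a) {γ δ : ℝ → ℝ}
    (hγ : ∀ s, HasDerivAt γ (a (γ s)) s) (hδ : ∀ s, HasDerivAt δ (a (δ s)) s)
    (h0 : γ 0 = δ 0) : γ = δ := by
  funext s
  have := integralCurve_sub_eq ha hγ hδ s
  rw [h0, sub_self, zero_mul, sub_eq_zero] at this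
  exact this.symm

/-- A bounded `C^1` vector field on the line has global integral curves. -/
theorem exists_integralCurve {a : ℝ → ℝ} (ha : ContDiff ℝ 1 a) (hb : ∀ x, |a x| ≤ 1) (x : ℝ) :
    ∃ γ : ℝ → ℝ, γ 0 = x ∧ ∀ s, HasDerivAt γ (a (γ s)) s := by
  -- Speed at most 1 keeps a solution in the ball of radius `|R|` during time `|R|`, so
  -- Picard–Lindelöf works on arbitrarily long intervals.
  have hloc : ∀ R : ℝ, ∃ γ : ℝ → ℝ, γ 0 = x ∧ ∀ s ∈ Ioo (-R) R, HasDerivAt γ (a (γ s)) s := by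
    intro R
    have hR : (0 : ℝ) ≤ |R| := abs_nonneg R
    obtain ⟨K, hK⟩ := (ha.locallyLipschitz).locallyLipschitzOn.exists_lipschitzOnWith_of_compact
      (isCompact_closedBall x |R|)
    have hPL : IsPicardLindelof (fun _ => a) (tmin := -|R|) (tmax := |R|)
        ⟨0, by simp⟩ x ⟨|R|, hR⟩ 0 1 K :=
      IsPicardLindelof.of_time_independent (fun y _ => by simpa using hb y) hK
        (by simp; exact le_refl |R|)
    obtain ⟨γ, h0, hγ⟩ := hPL.exists_eq_forall_mem_Icc_hasDerivWithinAt₀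
    refine ⟨γ, h0, fun s hs => ?_⟩
    have hs' : s ∈ Ioo (-|R|) |R| :=
      ⟨(neg_le_neg (le_abs_self R)).trans_lt hs.1, hs.2.trans_le (le_abs_self R)⟩
    exact (hγ s (Ioo_subset_Icc_self hs')).hasDerivAt (Icc_mem_nhds hs'.1 hs'.2)
  have hv : ContMDiff (modelWithCornersSelf ℝ ℝ) (modelWithCornersSelf ℝ ℝ).tangent 1
      (fun x => (⟨x, a x⟩ : TangentBundle (modelWithCornersSelf ℝ ℝ) ℝ)) :=
    contMDiff_vectorSpace_iff_contDiff.2 ha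
  obtain ⟨γ, h0, hγ⟩ := (exists_isMIntegralCurve_iff_exists_isMIntegralCurveOn_Ioo
    (v := fun x => a x) hv x).2 fun R => by
      obtain ⟨γ, h0, hγ⟩ := hloc R
      exact ⟨γ, h0, fun s hs => ((hγ s hs).hasFDerivAt.hasFDerivWithinAt).hasMFDerivWithinAt⟩
  refine ⟨γ, h0, fun s => ?_⟩
  have h : HasFDerivAt γ (ContinuousLinearMap.toSpanSingleton ℝ (a (γ s))) s :=
    (hγ s).hasFDerivAt
  exact h.hasDerivAt.congr_deriv (by simp)

/-- The flow of a bounded smooth vector field on the line is globally defined and smooth. -/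
theorem exists_smooth_flow {a : ℝ → ℝ} (ha : ContDiff ℝ ∞ a) (hb : ∀ x, |a x| ≤ 1) :
    ∃ Φ : ℝ × ℝ → ℝ, ContDiff ℝ ∞ Φ ∧
      (∀ s t, HasDerivAt (fun r => Φ (r, t)) (a (Φ (s, t))) s) ∧
      (∀ s t, Φ (-s, Φ (s, t)) = t) ∧ (∀ s t, Φ (s, Φ (-s, t)) = t) := by
  have ha1 : ContDiff ℝ 1 a := ha.of_le (by exact_mod_cast le_top)
  choose γ h0 hγ using exists_integralCurve ha1 hb
  have hinv : ∀ s t, γ (γ t s) (-s) = t := fun s t => by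
    have : γ (γ t s) = fun r => γ t (r + s) :=
      integralCurve_unique ha1 (hγ _) (fun r => (hγ t (r + s)).comp_add_const r s) (by simp [h0])
    simp [this, h0]
  have hcγ : ∀ t, Continuous (γ t) :=
    fun t => continuous_iff_continuousAt.2 fun s => (hγ t s).continuousAt
  have hlip : ∀ t s s', |γ t s - γ t s'| ≤ |s - s'| := fun t s s' => by
    have := (convex_univ (𝕜 := ℝ) (E := ℝ)).norm_image_sub_le_of_norm_hasDerivWithin_le
      (f := γ t) (C := 1) (fun r _ => (hγ t r).hasDerivWithinAt) (fun r _ => hb _)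
      (mem_univ s') (mem_univ s)
    simpa using this
  -- Joint continuity: the exponential formula controls the change of initial point, the Lipschitz
  -- bound the change of time. `R` bounds `|τ| + |r|` for all parameters within distance 1.
  have hc : Continuous fun z : ℝ × ℝ => γ z.2 z.1 := by
    rw [continuous_iff_continuousAt]
    rintro ⟨s₀, t₀⟩
    set R : ℝ := |s₀| + |t₀| + 3
    obtain ⟨K, hK⟩ := (isCompact_closedBall (0 : ℝ × ℝ) R).exists_bound_of_continuousOn
      (continuous_meanDeriv ha1).continuousOn
    have hbd : ∀ s t, |s - s₀| ≤ 1 → |t - t₀| ≤ 1 →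
        |γ t s - γ t₀ s₀| ≤ |t - t₀| * Real.exp (K * (|s₀| + 1)) + |s - s₀| := by
      intro s t hs ht
      have hs' : |s| ≤ |s₀| + 1 := by
        have := abs_sub_abs_le_abs_sub s s₀
        linarith
      have ht' : |t| ≤ |t₀| + 1 := by
        have := abs_sub_abs_le_abs_sub t t₀
        linarith
      have hin : ∀ τ r, |τ| ≤ |t₀| + 1 → |r| ≤ |s₀| + 1 → |γ τ r| ≤ R := by
        intro τ r hτ hr
        have h1 := hlip τ r 0
        rw [h0, sub_zero] at h1
        have h2 := abs_sub_abs_le_abs_sub (γ τ r) τ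
        simp only [R]
        linarith
      have hK' : ∀ r ∈ uIoc 0 s, ‖meanDeriv a (γ t₀ r, γ t r)‖ ≤ K := by
        intro r hr
        have hr' : |r| ≤ |s₀| + 1 := by
          have := abs_sub_left_of_mem_uIcc (uIoc_subset_uIcc hr)
          simp only [sub_zero] at this
          linarith
        refine hK _ ?_
        rw [mem_closedBall_zero_iff, Prod.norm_def]
        exact max_le (hin _ _ (by linarith) hr') (hin _ _ ht' hr')
      have hint := intervalIntegral.norm_integral_le_of_norm_le_const hK'
      have hK0 : 0 ≤ K := (norm_nonneg _).trans (hK 0 (by simp [R]; positivity))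
      have h1 : |γ t s - γ t₀ s| ≤ |t - t₀| * Real.exp (K * (|s₀| + 1)) := by
        rw [integralCurve_sub_eq ha1 (hγ t₀) (hγ t) s, h0, h0, abs_mul, Real.abs_exp]
        gcongr
        refine (le_abs_self _).trans (hint.trans ?_)
        rw [sub_zero]
        gcongr
      have h2 := hlip t₀ s s₀
      calc |γ t s - γ t₀ s₀| = |(γ t s - γ t₀ s) + (γ t₀ s - γ t₀ s₀)| := by ring_nf
        _ ≤ _ := (abs_add_le _ _).trans (add_le_add h1 h2)
    rw [ContinuousAt, tendsto_iff_norm_sub_tendsto_zero]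
    have hlim : Tendsto (fun z : ℝ × ℝ => |z.2 - t₀| * Real.exp (K * (|s₀| + 1)) + |z.1 - s₀|)
        (𝓝 (s₀, t₀)) (𝓝 0) := by
      have : Continuous fun z : ℝ × ℝ =>
        |z.2 - t₀| * Real.exp (K * (|s₀| + 1)) + |z.1 - s₀| := by fun_prop
      simpa using this.tendsto (s₀, t₀)
    refine squeeze_zero' (Eventually.of_forall fun _ => norm_nonneg _) ?_ hlim
    filter_upwards [Metric.closedBall_mem_nhds (s₀, t₀) one_pos] with z hz
    rw [Metric.mem_closedBall, Prod.dist_eq, max_le_iff, Real.dist_eq, Real.dist_eq] at hz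
    exact hbd z.1 z.2 hz.1 hz.2
  -- The difference quotient in the initial point is exactly an exponential, continuous in `τ`; at
  -- `τ = t` the mean derivative becomes `a'`.
  have hdt : ∀ s t, HasDerivAt (fun τ => γ τ s)
      (Real.exp (∫ r in (0 : ℝ)..s, deriv a (γ t r))) t := by
    intro s t
    have hE : Continuous fun τ => Real.exp (∫ r in (0 : ℝ)..s, meanDeriv a (γ t r, γ τ r)) := by
      refine Real.continuous_exp.comp
        (intervalIntegral.continuous_parametric_intervalIntegral_of_continuous'
          (f := fun τ r => meanDeriv a (γ t r, γ τ r)) ?_ 0 s)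
      refine (continuous_meanDeriv ha1).comp (Continuous.prodMk ?_ ?_)
      · exact (hcγ t).comp continuous_snd
      · exact hc.comp continuous_swap
    rw [hasDerivAt_iff_tendsto_slope]
    have h1 := (hE.tendsto t).mono_left (nhdsWithin_le_nhds (s := {t}ᶜ))
    simp only [meanDeriv_self] at h1
    refine h1.congr' ?_
    filter_upwards [self_mem_nhdsWithin] with τ hτ
    have hne : τ - t ≠ 0 := sub_ne_zero.2 hτ
    rw [slope_def_field, integralCurve_sub_eq ha1 (hγ t) (hγ τ) s, h0, h0,
      mul_div_cancel_left₀ _ hne]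
  refine ⟨fun z => γ z.2 z.1, ?_, fun s t => hγ t s, hinv, fun s t => ?_⟩
  · rw [contDiff_infty]
    intro n
    -- Bootstrap: both partials of the flow are as smooth as the flow itself.
    induction n with
    | zero => exact contDiff_zero.2 hc
    | succ n ih =>
      have han : ContDiff ℝ n a := ha.of_le (by exact_mod_cast le_top)
      have ha' : ContDiff ℝ n (deriv a) :=
        ((contDiff_infty_iff_deriv.1 ha).2).of_le (by exact_mod_cast le_top)
      exact contDiff_succ_of_partials (fun s t => hγ t s) (fun s t => hdt s t) (han.comp ih)
        (contDiff_primitive n (ha'.comp ih)).exp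
  · simpa using hinv (-s) t

end Flow

/-! ### Solving the equation when `q` has one sign on the zeros of `p`. -/

section Surjectivity

variable {E : Type*} [NormedAddCommGroup E] [NormedSpace ℝ E]

/-- A smooth function composed with a differentiable curve in the plane. -/
theorem ContDiff.hasDerivAt_comp_curve {u : ℝ × ℝ → E} (hu : ContDiff ℝ ∞ u) {α β : ℝ → ℝ}
    {α' β' s : ℝ} (hα : HasDerivAt α α' s) (hβ : HasDerivAt β β' s) :
    HasDerivAt (fun r => u (α r, β r))
      (α' • fderiv ℝ u (α s, β s) (1, 0) + β' • fderiv ℝ u (α s, β s) (0, 1)) s := by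
  have h := (hu.differentiable (by simp) (α s, β s)).hasFDerivAt.comp_hasDerivAt s (hα.prodMk hβ)
  refine h.congr_deriv ?_
  rw [← map_smul, ← map_smul, ← map_add]
  simp

/-- The equation `a(t) ∂ₜ v + ∂ₓ v = F` is solvable when `a` is smooth and bounded. -/
theorem exists_solution_of_bounded [CompleteSpace E] {a : ℝ → ℝ} (ha : ContDiff ℝ ∞ a)
    (hb : ∀ x, |a x| ≤ 1) {F : ℝ × ℝ → E} (hF : ContDiff ℝ ∞ F) :
    ∃ v : ℝ × ℝ → E, ContDiff ℝ ∞ v ∧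
      ∀ z, a z.1 • fderiv ℝ v z (1, 0) + fderiv ℝ v z (0, 1) = F z := by
  obtain ⟨Φ, hΦ, hd, hinv, hinv'⟩ := exists_smooth_flow ha hb
  have hH : ContDiff ℝ ∞ fun z : ℝ × ℝ => F (Φ z, z.1) := hF.comp (hΦ.prodMk contDiff_fst)
  set G : ℝ × ℝ → E := fun z => ∫ r in (0 : ℝ)..z.1, F (Φ (r, z.2), r)
  have hG : ContDiff ℝ ∞ G := contDiff_infty.2 fun n =>
    contDiff_primitive n (hH.of_le (by exact_mod_cast le_top))
  -- From `(t, x)`, flow back to the line `x = 0`, then integrate `F` along the trajectory up to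
  -- time `x`.
  have hv : ContDiff ℝ ∞ fun z : ℝ × ℝ => G (z.2, Φ (-z.2, z.1)) :=
    hG.comp (contDiff_snd.prodMk (hΦ.comp (contDiff_snd.neg.prodMk contDiff_fst)))
  refine ⟨_, hv, fun z => ?_⟩
  obtain ⟨t, y⟩ := z
  set t₀ := Φ (-y, t)
  have h1 := hv.hasDerivAt_comp_curve (hd y t₀) (hasDerivAt_id y)
  have h2 : HasDerivAt (fun y => G (y, t₀)) (F (Φ (y, t₀), y)) y := by
    have c : Continuous fun r => F (Φ (r, t₀), r) := hH.continuous.comp (g := fun z : ℝ × ℝ =>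
      F (Φ z, z.1)) (f := fun r => (r, t₀)) (by fun_prop)
    exact intervalIntegral.integral_hasDerivAt_right (c.intervalIntegrable _ _)
      (c.stronglyMeasurableAtFilter _ _) c.continuousAt
  simp only [id, hinv] at h1
  have h3 := h1.unique h2
  rw [hinv' y t, one_smul] at h3
  exact h3

/-- If `q` is positive at the zeros of `p`, then `p ∂ₜ + q ∂ₓ` is surjective. -/
theorem exists_solution_of_pos_at_zeros [CompleteSpace E] {p q : ℝ → ℝ} (hp : ContDiff ℝ ∞ p)
    (hq : ContDiff ℝ ∞ q) (hpos : ∀ s, p s = 0 → 0 < q s) {f : ℝ × ℝ → E}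
    (hf : ContDiff ℝ ∞ f) :
    ∃ u : ℝ × ℝ → E, ContDiff ℝ ∞ u ∧
      ∀ z, p z.1 • fderiv ℝ u z (1, 0) + q z.1 • fderiv ℝ u z (0, 1) = f z := by
  have hpq : ∀ s, 0 < p s ^ 2 + q s ^ 2 := fun s => by
    by_cases h : p s = 0
    · have := hpos s h
      positivity
    · positivity
  set ψ : ℝ → ℝ := fun s => √(p s ^ 2 + q s ^ 2)
  have hψ : ContDiff ℝ ∞ ψ := ((hp.pow 2).add (hq.pow 2)).sqrt fun s => (hpq s).ne'
  have hψ0 : ∀ s, 0 < ψ s := fun s => Real.sqrt_pos.2 (hpq s)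
  have hψ2 : ∀ s, ψ s ^ 2 = p s ^ 2 + q s ^ 2 := fun s => Real.sq_sqrt (hpq s).le
  -- Where `p ≠ 0`, `|q| < ψ`; where `p = 0`, the sign hypothesis on `q` is decisive.
  have hψq : ∀ s, 0 < ψ s + q s := fun s => by
    by_cases h : p s = 0
    · exact add_pos (hψ0 s) (hpos s h)
    · have h1 : |q s| < ψ s := Real.lt_sqrt_of_sq_lt (by
        rw [sq_abs]
        have : 0 < p s ^ 2 := by positivity
        linarith)
      linarith [neg_abs_le (q s)]
  -- This slope of the shear gives `p g + q = ψ`, because `p² = (ψ - q)(ψ + q)`.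
  set g : ℝ → ℝ := fun s => p s / (ψ s + q s)
  have hg : ContDiff ℝ ∞ g := hp.div (hψ.add hq) fun s => (hψq s).ne'
  set h : ℝ → ℝ := fun s => ∫ r in (0 : ℝ)..s, g r
  have hd : ∀ s, HasDerivAt h (g s) s := fun s =>
    intervalIntegral.integral_hasDerivAt_right (hg.continuous.intervalIntegrable _ _)
      (hg.continuous.stronglyMeasurableAtFilter _ _) hg.continuous.continuousAt
  have hh : ContDiff ℝ ∞ h := contDiff_infty_iff_deriv.2
    ⟨fun s => (hd s).differentiableAt, by rwa [funext fun s => (hd s).deriv]⟩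
  have hgψ : ∀ s, p s * g s + q s = ψ s := fun s => by
    have := (hψq s).ne'
    simp only [g]
    field_simp
    linarith [hψ2 s]
  have ha : ContDiff ℝ ∞ fun s => p s / ψ s := hp.div hψ fun s => (hψ0 s).ne'
  have hb : ∀ s, |p s / ψ s| ≤ 1 := fun s => by
    rw [abs_div, abs_of_pos (hψ0 s), div_le_one (hψ0 s)]
    exact Real.abs_le_sqrt (by linarith [sq_nonneg (q s)])
  have hF : ContDiff ℝ ∞ fun z : ℝ × ℝ => (ψ z.1)⁻¹ • f (z.1, z.2 - h z.1) :=
    ((hψ.comp contDiff_fst).inv fun z => (hψ0 z.1).ne').smul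
      (hf.comp (contDiff_fst.prodMk (contDiff_snd.sub (hh.comp contDiff_fst))))
  obtain ⟨v, hv, hvF⟩ := exists_solution_of_bounded ha hb hF
  have hu : ContDiff ℝ ∞ fun z : ℝ × ℝ => v (z.1, z.2 + h z.1) :=
    hv.comp (contDiff_fst.prodMk (contDiff_snd.add (hh.comp contDiff_fst)))
  refine ⟨_, hu, fun z => ?_⟩
  obtain ⟨t, x⟩ := z
  have e₁ : fderiv ℝ (fun z : ℝ × ℝ => v (z.1, z.2 + h z.1)) (t, x) (1, 0) =
      fderiv ℝ v (t, x + h t) (1, 0) + g t • fderiv ℝ v (t, x + h t) (0, 1) := by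
    have h1 := (hu.of_le (m := 1) (by exact_mod_cast le_top)).hasDerivAt_fst t x
    have h2 := hv.hasDerivAt_comp_curve (hasDerivAt_id t) ((hd t).const_add x)
    rw [one_smul] at h2
    exact h1.unique h2
  have e₂ : fderiv ℝ (fun z : ℝ × ℝ => v (z.1, z.2 + h z.1)) (t, x) (0, 1) =
      fderiv ℝ v (t, x + h t) (0, 1) := by
    have h1 := (hu.of_le (m := 1) (by exact_mod_cast le_top)).hasDerivAt_snd t x
    have h2 := hv.hasDerivAt_comp_curve (hasDerivAt_const x t) ((hasDerivAt_id x).add_const (h t))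
    rw [one_smul, zero_smul, zero_add] at h2
    exact h1.unique h2
  have e := congrArg (ψ t • ·) (hvF (t, x + h t))
  simp only [smul_add, smul_smul, mul_div_cancel₀ _ (hψ0 t).ne', mul_inv_cancel₀ (hψ0 t).ne',
    one_smul, add_sub_cancel_right] at e
  rw [e₁, e₂, smul_add, smul_smul, add_assoc, ← add_smul, hgψ]
  exact e

theorem Polynomial.contDiff_eval (p : ℝ[X]) : ContDiff ℝ ∞ fun s => p.eval s := by
  simpa [Polynomial.aeval_def, Polynomial.eval₂_eq_eval_map] using p.contDiff_aeval (𝕜 := ℝ) ∞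

/-- If `q` has a constant strict sign on the zeros of `p`, then `L` is surjective. -/
theorem surjectiveOnSmooth_of_sign (𝕜 : Type*) [RCLike 𝕜] {p q : ℝ[X]}
    (h : (∀ s, p.eval s = 0 → 0 < q.eval s) ∨ (∀ s, p.eval s = 0 → q.eval s < 0)) :
    SurjectiveOnSmooth 𝕜 p q := by
  intro f hf
  rcases h with h | h
  · obtain ⟨u, hu, hL⟩ := exists_solution_of_pos_at_zeros p.contDiff_eval q.contDiff_eval h hf
    exact ⟨u, hu, funext hL⟩
  · obtain ⟨u, hu, hL⟩ := exists_solution_of_pos_at_zeros (p := fun s => -p.eval s)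
      (q := fun s => -q.eval s) p.contDiff_eval.neg q.contDiff_eval.neg
      (fun s hs => neg_pos.2 (h s (neg_eq_zero.1 hs))) (ContDiff.neg hf)
    refine ⟨u, hu, funext fun z => ?_⟩
    have := hL z
    simp only [neg_smul, ← neg_add, neg_inj] at this
    exact this

end Surjectivity

/-! ### Behaviour of characteristics at the ends of a strip. -/

section Limits

theorem mul_pos_of_forall_ne_zero {f : ℝ → ℝ} (hf : Continuous f) {s t : ℝ}
    (h : ∀ r ∈ uIcc s t, f r ≠ 0) : 0 < f s * f t := by
  by_contra hneg
  have h0 : (0 : ℝ) ∈ uIcc (f s) (f t) := by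
    rw [mem_uIcc]
    rcases mul_nonpos_iff.1 (not_lt.1 hneg) with h | h
    · exact Or.inr ⟨h.2, h.1⟩
    · exact Or.inl h
  obtain ⟨r, hr, hr0⟩ := intermediate_value_uIcc hf.continuousOn h0
  exact h r hr hr0

/-- If `(t - a) x'(t)` has a positive limit at `a`, then `x` tends to `-∞` there. -/
theorem tendsto_atBot_nhdsGT_of_deriv {x x' : ℝ → ℝ} {a b c : ℝ} (hab : a < b)
    (hx : ∀ t ∈ Ioo a b, HasDerivAt x (x' t) t) (hc : 0 < c)
    (h : Tendsto (fun t => (t - a) * x' t) (𝓝[>] a) (𝓝 c)) : Tendsto x (𝓝[>] a) atBot := by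
  have h1 : ∀ᶠ t in 𝓝[>] a, c / 2 < (t - a) * x' t ∧ t ∈ Ioo a b :=
    (h.eventually (lt_mem_nhds (half_lt_self hc))).and (Ioo_mem_nhdsGT hab)
  obtain ⟨d, hd, hsub⟩ := mem_nhdsGT_iff_exists_Ioo_subset.1 h1
  -- Near `a`, `x' > (c / 2) / (t - a)`, so `x` minus `(c / 2) log (t - a)` increases, and `x` lies
  -- below a constant plus that logarithm.
  have had : a < d := hd
  set y : ℝ → ℝ := fun t => x t - c / 2 * Real.log (t - a)
  have hy : ∀ t ∈ Ioo a d, HasDerivAt y (x' t - c / 2 * (1 / (t - a))) t := fun t ht =>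
    (hx t (hsub ht).2).sub
      ((((hasDerivAt_id t).sub_const a).log (sub_pos.2 ht.1).ne').const_mul (c / 2))
  have hmono : MonotoneOn y (Ioo a d) := by
    refine monotoneOn_of_deriv_nonneg (convex_Ioo a d)
      (fun t ht => (hy t ht).continuousAt.continuousWithinAt)
      (fun t ht => (hy t (interior_subset ht)).differentiableAt.differentiableWithinAt)
      fun t ht => ?_
    have ht' := interior_subset ht
    rw [(hy t ht').deriv, sub_nonneg, mul_one_div, div_le_iff₀ (sub_pos.2 ht'.1), mul_comm]
    exact (hsub ht').1.le
  obtain ⟨m, hm⟩ := exists_between had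
  have hlog : Tendsto (fun t => y m + c / 2 * Real.log (t - a)) (𝓝[>] a) atBot := by
    have h2 : Tendsto (fun t : ℝ => t - a) (𝓝[>] a) (𝓝[>] 0) := by
      refine tendsto_nhdsWithin_iff.2 ⟨?_, ?_⟩
      · have : Continuous fun t : ℝ => t - a := by fun_prop
        simpa using (this.tendsto a).mono_left nhdsWithin_le_nhds
      · filter_upwards [self_mem_nhdsWithin] with t ht using sub_pos.2 (mem_Ioi.1 ht)
    exact tendsto_atBot_add_const_left _ _
      ((Real.tendsto_log_nhdsGT_zero.comp h2).const_mul_atBot (half_pos hc))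
  refine tendsto_atBot_mono' _ ?_ hlog
  filter_upwards [Ioo_mem_nhdsGT hm.1] with t ht
  have := hmono ⟨ht.1, ht.2.trans hm.2⟩ hm ht.2.le
  simp only [y] at this ⊢
  linarith

theorem tendsto_atTop_nhdsGT_of_deriv {x x' : ℝ → ℝ} {a b c : ℝ} (hab : a < b)
    (hx : ∀ t ∈ Ioo a b, HasDerivAt x (x' t) t) (hc : c < 0)
    (h : Tendsto (fun t => (t - a) * x' t) (𝓝[>] a) (𝓝 c)) : Tendsto x (𝓝[>] a) atTop := by
  have := tendsto_atBot_nhdsGT_of_deriv hab (fun t ht => (hx t ht).neg) (neg_pos.2 hc)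
    (h.neg.congr fun t => by ring)
  simpa [Function.comp_def] using tendsto_neg_atBot_atTop.comp this

/-- The reflection `s = -t` transfers limits at right ends to left ends; it leaves the product `(t -
b) x'(t)` unchanged, hence also the sign of its limit. -/
theorem tendsto_comp_neg_nhdsGT {α : Type*} {f : ℝ → α} {b : ℝ} {l : Filter α}
    (h : Tendsto f (𝓝[<] b) l) : Tendsto (fun s => f (-s)) (𝓝[>] (-b)) l := by
  refine h.comp (tendsto_nhdsWithin_iff.2 ⟨?_, ?_⟩)
  · simpa using (continuous_neg.tendsto (-b)).mono_left nhdsWithin_le_nhds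
  · filter_upwards [self_mem_nhdsWithin] with t ht using neg_lt.1 (mem_Ioi.1 ht)

theorem tendsto_nhdsLT_of_comp_neg {α : Type*} {f : ℝ → α} {b : ℝ} {l : Filter α}
    (h : Tendsto (fun s => f (-s)) (𝓝[>] (-b)) l) : Tendsto f (𝓝[<] b) l := by
  have h1 : Tendsto (fun s : ℝ => -s) (𝓝[<] b) (𝓝[>] (-b)) := by
    refine tendsto_nhdsWithin_iff.2 ⟨(continuous_neg.tendsto b).mono_left nhdsWithin_le_nhds, ?_⟩
    filter_upwards [self_mem_nhdsWithin] with t ht using neg_lt_neg (mem_Iio.1 ht)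
  simpa [Function.comp_def] using h.comp h1

theorem hasDerivAt_comp_neg_Ioo {x x' : ℝ → ℝ} {a b : ℝ}
    (hx : ∀ t ∈ Ioo a b, HasDerivAt x (x' t) t) :
    ∀ s ∈ Ioo (-b) (-a), HasDerivAt (fun s => x (-s)) (-x' (-s)) s := fun s hs => by
  have := (hx (-s) ⟨lt_neg.1 hs.2, neg_lt.1 hs.1⟩).scomp s (hasDerivAt_neg s)
  simpa [Function.comp_def] using this

/-- If `(t - b) x'(t)` has a positive limit at `b`, then `x` tends to `-∞` there. -/
theorem tendsto_atBot_nhdsLT_of_deriv {x x' : ℝ → ℝ} {a b c : ℝ} (hab : a < b)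
    (hx : ∀ t ∈ Ioo a b, HasDerivAt x (x' t) t) (hc : 0 < c)
    (h : Tendsto (fun t => (t - b) * x' t) (𝓝[<] b) (𝓝 c)) : Tendsto x (𝓝[<] b) atBot :=
  tendsto_nhdsLT_of_comp_neg <| tendsto_atBot_nhdsGT_of_deriv (neg_lt_neg hab)
    (hasDerivAt_comp_neg_Ioo hx) hc ((tendsto_comp_neg_nhdsGT h).congr fun t => by ring)

theorem tendsto_atTop_nhdsLT_of_deriv {x x' : ℝ → ℝ} {a b c : ℝ} (hab : a < b)
    (hx : ∀ t ∈ Ioo a b, HasDerivAt x (x' t) t) (hc : c < 0)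
    (h : Tendsto (fun t => (t - b) * x' t) (𝓝[<] b) (𝓝 c)) : Tendsto x (𝓝[<] b) atTop :=
  tendsto_nhdsLT_of_comp_neg <| tendsto_atTop_nhdsGT_of_deriv (neg_lt_neg hab)
    (hasDerivAt_comp_neg_Ioo hx) hc ((tendsto_comp_neg_nhdsGT h).congr fun t => by ring)

theorem tendsto_slope_polynomial {p : ℝ[X]} {e : ℝ} (he : p.eval e = 0) :
    Tendsto (fun t => p.eval t / (t - e)) (𝓝[≠] e) (𝓝 (p.derivative.eval e)) := by
  refine ((hasDerivAt_iff_tendsto_slope.1 (p.hasDerivAt e))).congr fun t => ?_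
  rw [slope_def_field, he, sub_zero]

/-- The limit of `(t - e) q(t) / p(t)`, the residue of `q / p` at a simple zero of `p`. -/
theorem tendsto_sub_mul_div {p : ℝ[X]} (q : ℝ[X]) {e : ℝ} (he : p.eval e = 0)
    (hd : p.derivative.eval e ≠ 0) :
    Tendsto (fun t => (t - e) * (q.eval t / p.eval t)) (𝓝[≠] e)
      (𝓝 (q.eval e / p.derivative.eval e)) := by
  refine (((q.continuous.tendsto e).mono_left nhdsWithin_le_nhds).div
    (tendsto_slope_polynomial he) hd).congr fun t => ?_
  rw [Pi.div_apply, div_div_eq_mul_div, mul_comm, mul_div_assoc]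

/-- At two consecutive simple zeros the derivatives of `p` have opposite signs. -/
theorem derivative_mul_derivative_neg {p : ℝ[X]} {a b : ℝ} (hab : a < b) (pa : p.eval a = 0)
    (pb : p.eval b = 0) (hp : ∀ s ∈ Ioo a b, p.eval s ≠ 0) (da : p.derivative.eval a ≠ 0)
    (db : p.derivative.eval b ≠ 0) : p.derivative.eval a * p.derivative.eval b < 0 := by
  -- Near a simple zero `e`, `p t / (t - e)` has the sign of `p' e`. Here `p` keeps its sign across
  -- the strip, while `t - a > 0 > t - b`.
  have key : ∀ e, p.eval e = 0 → p.derivative.eval e ≠ 0 →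
      ∀ᶠ t in 𝓝[≠] e, 0 < p.eval t / (t - e) * p.derivative.eval e := fun e he hd =>
    ((tendsto_slope_polynomial he).mul_const _).eventually (lt_mem_nhds (mul_self_pos.2 hd))
  obtain ⟨s, hs, hs'⟩ := (((key a pa da).filter_mono (nhdsGT_le_nhdsNE a)).and
    (Ioo_mem_nhdsGT hab)).exists
  obtain ⟨t, ht, ht'⟩ := (((key b pb db).filter_mono (nhdsLT_le_nhdsNE b)).and
    (Ioo_mem_nhdsLT hab)).exists
  have hst : 0 < p.eval s * p.eval t := mul_pos_of_forall_ne_zero p.continuous fun r hr =>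
    hp r (ordConnected_Ioo.uIcc_subset hs' ht' hr)
  have h1 : 0 < p.eval s * p.derivative.eval a := by
    have := mul_pos hs (sub_pos.2 hs'.1)
    have hne := (sub_pos.2 hs'.1).ne'
    field_simp at this
    linarith
  have h2 : p.eval t * p.derivative.eval b < 0 := by
    have := mul_neg_of_pos_of_neg ht (sub_neg.2 ht'.2)
    have hne := (sub_neg.2 ht'.2).ne
    field_simp at this
    linarith
  have h3 := mul_neg_of_pos_of_neg h1 h2
  have h4 : (p.eval s * p.eval t) * (p.derivative.eval a * p.derivative.eval b) < 0 := by
    linarith [h3]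
  exact (pos_iff_neg_of_mul_neg h4).1 hst

/-- If `q` has opposite signs at the ends of the strip, then the strip is a separatrix. -/
theorem isSeparatrix_of_mul_neg {p q : ℝ[X]} {a b : ℝ} (hab : a < b) (pa : p.eval a = 0)
    (pb : p.eval b = 0) (hp : ∀ s ∈ Ioo a b, p.eval s ≠ 0) (da : p.derivative.eval a ≠ 0)
    (db : p.derivative.eval b ≠ 0) (hq : q.eval a * q.eval b < 0) : IsSeparatrix p q a b := by
  rintro τ - y x ⟨hx, -⟩
  have hd := derivative_mul_derivative_neg hab pa pb hp da db
  have la := (tendsto_sub_mul_div q pa da).mono_left (nhdsGT_le_nhdsNE a)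
  have lb := (tendsto_sub_mul_div q pb db).mono_left (nhdsLT_le_nhdsNE b)
  have hab' : 0 < (q.eval a / p.derivative.eval a) * (q.eval b / p.derivative.eval b) := by
    rw [div_mul_div_comm]
    exact div_pos_of_neg_of_neg hq hd
  rcases pos_and_pos_or_neg_and_neg_of_mul_pos hab' with h | h
  · exact Or.inr ⟨tendsto_atBot_nhdsGT_of_deriv hab hx h.1 la,
      tendsto_atBot_nhdsLT_of_deriv hab hx h.2 lb⟩
  · exact Or.inl ⟨tendsto_atTop_nhdsGT_of_deriv hab hx h.1 la,
      tendsto_atTop_nhdsLT_of_deriv hab hx h.2 lb⟩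

end Limits

/-! ### A separatrix obstructs `L u = 1`. -/

section NonSurjectivity

/-- A characteristic curve exists in each strip free of zeros of `p`. -/
theorem exists_isCharacteristic {p : ℝ[X]} (q : ℝ[X]) {a b τ : ℝ}
    (hp : ∀ s ∈ Ioo a b, p.eval s ≠ 0) (hτ : τ ∈ Ioo a b) :
    ∃ x, IsCharacteristic p q a b τ 0 x := by
  have hc : ContinuousOn (fun s => q.eval s / p.eval s) (Ioo a b) :=
    q.continuous.continuousOn.div p.continuous.continuousOn hp
  refine ⟨fun t => ∫ s in τ..t, q.eval s / p.eval s, fun t ht => ?_, by simp⟩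
  exact intervalIntegral.integral_hasDerivAt_right
    ((hc.mono (ordConnected_Ioo.uIcc_subset hτ ht)).intervalIntegrable)
    (hc.stronglyMeasurableAtFilter isOpen_Ioo t ht) (hc.continuousAt (isOpen_Ioo.mem_nhds ht))

/-- A function tending to `+∞` at both ends takes a common value arbitrarily close to them. -/
theorem exists_eq_near_ends_of_atTop {X : ℝ → ℝ} {a b : ℝ} (hab : a < b)
    (hX : ContinuousOn X (Ioo a b)) (ha : Tendsto X (𝓝[>] a) atTop)
    (hb : Tendsto X (𝓝[<] b) atTop) {P Q : Set ℝ} (hP : P ∈ 𝓝[>] a) (hQ : Q ∈ 𝓝[<] b) :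
    ∃ s ∈ P ∩ Ioo a b, ∃ t ∈ Q ∩ Ioo a b, X s = X t := by
  obtain ⟨d, hd, hdP⟩ := mem_nhdsGT_iff_exists_Ioo_subset.1 (inter_mem hP (Ioo_mem_nhdsGT hab))
  obtain ⟨e, he, heQ⟩ := mem_nhdsLT_iff_exists_Ioo_subset.1 (inter_mem hQ (Ioo_mem_nhdsLT hab))
  obtain ⟨s₁, hs₁⟩ := exists_between (mem_Ioi.1 hd)
  obtain ⟨t₁, ht₁⟩ := exists_between (mem_Iio.1 he)
  -- `X` reaches this level between `s₁` and `a`, and again between `t₁` and `b`.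
  set M := max (X s₁) (X t₁)
  obtain ⟨s₂, hs₂, hs₂'⟩ := ((ha.eventually_ge_atTop M).and (Ioo_mem_nhdsGT hs₁.1)).exists
  obtain ⟨t₂, ht₂, ht₂'⟩ := ((hb.eventually_ge_atTop M).and (Ioo_mem_nhdsLT ht₁.2)).exists
  have hsub₁ : Icc s₂ s₁ ⊆ Ioo a d := fun r hr => ⟨hs₂'.1.trans_le hr.1, hr.2.trans_lt hs₁.2⟩
  have hsub₂ : Icc t₁ t₂ ⊆ Ioo e b := fun r hr => ⟨ht₁.1.trans_le hr.1, hr.2.trans_lt ht₂'.2⟩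
  obtain ⟨s, hs, hsM⟩ := intermediate_value_Icc' hs₂'.2.le
    (hX.mono fun r hr => (hdP (hsub₁ hr)).2) ⟨le_max_left _ _, hs₂⟩
  obtain ⟨t, ht, htM⟩ := intermediate_value_Icc ht₂'.1.le
    (hX.mono fun r hr => (heQ (hsub₂ hr)).2) ⟨le_max_right _ _, ht₂⟩
  exact ⟨s, hdP (hsub₁ hs), t, heQ (hsub₂ ht), hsM.trans htM.symm⟩

theorem exists_eq_near_ends {X : ℝ → ℝ} {a b : ℝ} (hab : a < b)
    (hX : ContinuousOn X (Ioo a b))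
    (h : (Tendsto X (𝓝[>] a) atTop ∧ Tendsto X (𝓝[<] b) atTop) ∨
      (Tendsto X (𝓝[>] a) atBot ∧ Tendsto X (𝓝[<] b) atBot))
    {P Q : Set ℝ} (hP : P ∈ 𝓝[>] a) (hQ : Q ∈ 𝓝[<] b) :
    ∃ s ∈ P ∩ Ioo a b, ∃ t ∈ Q ∩ Ioo a b, X s = X t := by
  rcases h with h | h
  · exact exists_eq_near_ends_of_atTop hab hX h.1 h.2 hP hQ
  · obtain ⟨s, hs, t, ht, hst⟩ := exists_eq_near_ends_of_atTop hab hX.neg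
      (tendsto_neg_atBot_atTop.comp h.1) (tendsto_neg_atBot_atTop.comp h.2) hP hQ
    exact ⟨s, hs, t, ht, neg_injective hst⟩

/-- The travel time between points near the two ends of a strip is unbounded. -/
theorem exists_nhds_lt_abs_time_sub {p : ℝ[X]} {a b : ℝ} (hab : a < b) (pa : p.eval a = 0)
    (pb : p.eval b = 0) (hp : ∀ s ∈ Ioo a b, p.eval s ≠ 0) (da : p.derivative.eval a ≠ 0)
    (db : p.derivative.eval b ≠ 0) {T : ℝ → ℝ}
    (hT : ∀ t ∈ Ioo a b, HasDerivAt T ((1 : ℝ[X]).eval t / p.eval t) t) (B : ℝ) :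
    ∃ P ∈ 𝓝[>] a, ∃ Q ∈ 𝓝[<] b, ∀ s ∈ P, ∀ t ∈ Q, B < |T t - T s| := by
  have la := (tendsto_sub_mul_div 1 pa da).mono_left (nhdsGT_le_nhdsNE a)
  have lb := (tendsto_sub_mul_div 1 pb db).mono_left (nhdsLT_le_nhdsNE b)
  rw [eval_one] at la lb
  rcases mul_neg_iff.1 (derivative_mul_derivative_neg hab pa pb hp da db) with h | h
  · have ha := tendsto_atBot_nhdsGT_of_deriv hab hT (one_div_pos.2 h.1) la
    have hb := tendsto_atTop_nhdsLT_of_deriv hab hT (one_div_neg.2 h.2) lb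
    refine ⟨_, ha.eventually_lt_atBot 0, _, hb.eventually_gt_atTop B, fun s hs t ht => ?_⟩
    have hs' : T s < 0 := hs
    have ht' : B < T t := ht
    exact lt_of_lt_of_le (by linarith) (le_abs_self _)
  · have ha := tendsto_atTop_nhdsGT_of_deriv hab hT (one_div_neg.2 h.1) la
    have hb := tendsto_atBot_nhdsLT_of_deriv hab hT (one_div_pos.2 h.2) lb
    refine ⟨_, ha.eventually_gt_atTop B, _, hb.eventually_lt_atBot 0, fun s hs t ht => ?_⟩
    have hs' : B < T s := hs
    have ht' : T t < 0 := ht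
    exact lt_of_lt_of_le (by linarith) (neg_le_abs _)

/-- If some strip is a separatrix, then `L u = 1` has no smooth solution. -/
theorem not_surjectiveOnSmooth_of_isSeparatrix (𝕜 : Type*) [RCLike 𝕜] {p q : ℝ[X]} {a b : ℝ}
    (hab : a < b) (pa : p.eval a = 0) (pb : p.eval b = 0) (hp : ∀ s ∈ Ioo a b, p.eval s ≠ 0)
    (da : p.derivative.eval a ≠ 0) (db : p.derivative.eval b ≠ 0) (h : IsSeparatrix p q a b) :
    ¬ SurjectiveOnSmooth 𝕜 p q := by
  intro hsurj
  obtain ⟨u, hu, hLu⟩ := hsurj (show ContDiff ℝ ∞ fun _ : ℝ × ℝ => (1 : 𝕜) from contDiff_const)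
  have hu' : ContDiff ℝ ∞ u := hu
  obtain ⟨τ, hτ⟩ := exists_between hab
  obtain ⟨X, hX⟩ := exists_isCharacteristic q hp hτ
  -- The travel time, a primitive of `1 / p`, is a characteristic for `q = 1`.
  obtain ⟨T, hT⟩ := exists_isCharacteristic 1 hp hτ
  have hends := h τ hτ 0 X hX
  have hXc : ContinuousOn X (Ioo a b) := fun t ht => (hX.1 t ht).continuousAt.continuousWithinAt
  obtain ⟨B, hB⟩ := (isCompact_Icc (a := a) (b := b)).exists_bound_of_continuousOn
    (f := fun t => u (t, 0)) (hu'.continuous.comp (by fun_prop)).continuousOn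
  obtain ⟨P, hP, Q, hQ, hPQ⟩ := exists_nhds_lt_abs_time_sub hab pa pb hp da db hT.1 (2 * B)
  obtain ⟨s, hs, t, ht, hst⟩ := exists_eq_near_ends hab hXc hends hP hQ
  -- The characteristic lowered by `X s` crosses `x = 0` at both `s` and `t`; along it `u - T` is
  -- constant.
  have hw : ∀ r ∈ Ioo a b, HasDerivAt (fun r => u (r, X r - X s) - T r • (1 : 𝕜)) 0 r := by
    intro r hr
    have h1 := hu'.hasDerivAt_comp_curve (hasDerivAt_id r) ((hX.1 r hr).sub_const (X s))
    refine (h1.sub ((hT.1 r hr).smul_const (1 : 𝕜))).congr_deriv ?_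
    have h2 := congrFun hLu (r, X r - X s)
    simp only [planeField] at h2
    have h3 := congrArg ((p.eval r)⁻¹ • ·) h2
    simp only [smul_add, smul_smul, inv_mul_cancel₀ (hp r hr), one_smul] at h3
    rw [one_smul, eval_one, one_div, ← h3, id, div_eq_inv_mul, sub_self]
  have hconst := (convex_Ioo a b).norm_image_sub_le_of_norm_hasDerivWithin_le (C := 0)
    (fun r hr => (hw r hr).hasDerivWithinAt) (fun r _ => by simp) hs.2 ht.2
  rw [zero_mul, norm_le_zero_iff, ← hst, sub_self] at hconst
  have heq : u (t, 0) - u (s, 0) = (T t - T s) • (1 : 𝕜) := by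
    rw [sub_smul]
    linear_combination hconst
  have hle : ‖u (t, 0) - u (s, 0)‖ ≤ 2 * B :=
    (norm_sub_le _ _).trans (by
      linarith [hB t (Ioo_subset_Icc_self ht.2), hB s (Ioo_subset_Icc_self hs.2)])
  rw [heq, norm_smul, norm_one, mul_one, Real.norm_eq_abs] at hle
  exact (hPQ s hs.1 t ht.1).not_ge hle

end NonSurjectivity

/-! ### Sign changes of `q` within a strip. -/

section Signs

/-- The intermediate value theorem gives a zero; being the only one, it leaves `f` with the sign of
the nearer endpoint value on each side. -/
theorem exists_oppositeSigns_of_mul_neg {f : ℝ → ℝ} (hf : Continuous f) {a b : ℝ} (hab : a < b)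
    (h : f a * f b < 0) (hz : {s | s ∈ Ioo a b ∧ f s = 0}.Subsingleton) :
    ∃ θ ∈ Ioo a b, f θ = 0 ∧ OppositeSigns f a θ b := by
  have ha : f a ≠ 0 := left_ne_zero_of_mul h.ne
  have hb : f b ≠ 0 := right_ne_zero_of_mul h.ne
  obtain ⟨θ, hθ, h0⟩ : ∃ θ ∈ Icc a b, f θ = 0 := by
    by_contra! hne
    refine h.not_gt (mul_pos_of_forall_ne_zero hf fun r hr => hne r ?_)
    rwa [uIcc_of_le hab.le] at hr
  have hθ' : θ ∈ Ioo a b :=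
    ⟨hθ.1.lt_of_ne fun e => ha (e ▸ h0), hθ.2.lt_of_ne fun e => hb (e ▸ h0)⟩
  have hne : ∀ r ∈ Icc a b, r ≠ θ → f r ≠ 0 := fun r hr hrθ hr0 => by
    refine hrθ (hz ⟨⟨hr.1.lt_of_ne fun e => ha (e ▸ hr0), hr.2.lt_of_ne fun e => hb (e ▸ hr0)⟩,
      hr0⟩ ⟨hθ', h0⟩)
  have h1 : ∀ s ∈ Ioo a θ, 0 < f a * f s := fun s hs =>
    mul_pos_of_forall_ne_zero hf fun r hr => by
      rw [uIcc_of_le hs.1.le] at hr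
      exact hne r ⟨hr.1, (hr.2.trans hs.2.le).trans hθ.2⟩ (hr.2.trans_lt hs.2).ne
  have h2 : ∀ s ∈ Ioo θ b, 0 < f s * f b := fun s hs =>
    mul_pos_of_forall_ne_zero hf fun r hr => by
      rw [uIcc_of_le hs.2.le] at hr
      exact hne r ⟨hθ.1.trans (hs.1.le.trans hr.1), hr.2⟩ (hs.1.trans_le hr.1).ne'
  refine ⟨θ, hθ', h0, ?_⟩
  rcases mul_neg_iff.1 h with h | h
  · exact Or.inl ⟨fun s hs => (pos_iff_pos_of_mul_pos (h1 s hs)).1 h.1,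
      fun s hs => (neg_iff_neg_of_mul_pos (h2 s hs)).2 h.2⟩
  · exact Or.inr ⟨fun s hs => (neg_iff_neg_of_mul_pos (h1 s hs)).1 h.1,
      fun s hs => (pos_iff_pos_of_mul_pos (h2 s hs)).2 h.2⟩

/-- As `f` does not vanish at the ends, its signs inside extend to them by continuity. -/
theorem OppositeSigns.mul_neg {f : ℝ → ℝ} (hf : Continuous f) {a θ b : ℝ} (hθ : θ ∈ Ioo a b)
    (h : OppositeSigns f a θ b) (ha : f a ≠ 0) (hb : f b ≠ 0) : f a * f b < 0 := by
  obtain ⟨s, hs⟩ := exists_between hθ.1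
  obtain ⟨t, ht⟩ := exists_between hθ.2
  have hne : (∀ r ∈ Ioo a θ, f r ≠ 0) ∧ (∀ r ∈ Ioo θ b, f r ≠ 0) := by
    rcases h with h | h
    · exact ⟨fun r hr => (h.1 r hr).ne', fun r hr => (h.2 r hr).ne⟩
    · exact ⟨fun r hr => (h.1 r hr).ne, fun r hr => (h.2 r hr).ne'⟩
  have h1 : 0 < f a * f s := mul_pos_of_forall_ne_zero hf fun r hr => by
    rw [uIcc_of_le hs.1.le] at hr
    rcases hr.1.eq_or_lt with e | hlt
    · exact e ▸ ha
    · exact hne.1 r ⟨hlt, hr.2.trans_lt hs.2⟩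
  have h2 : 0 < f t * f b := mul_pos_of_forall_ne_zero hf fun r hr => by
    rw [uIcc_of_le ht.2.le] at hr
    rcases hr.2.eq_or_lt with e | hlt
    · exact e ▸ hb
    · exact hne.2 r ⟨ht.1.trans_le hr.1, hlt⟩
  rcases h with h | h
  · exact mul_neg_of_pos_of_neg ((pos_iff_pos_of_mul_pos h1).2 (h.1 s hs))
      ((neg_iff_neg_of_mul_pos h2).1 (h.2 t ht))
  · exact mul_neg_of_neg_of_pos ((neg_iff_neg_of_mul_pos h1).2 (h.1 s hs))
      ((pos_iff_pos_of_mul_pos h2).1 (h.2 t ht))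

end Signs

/-! ### The equivalence and the example. -/

theorem tfae_not_surjectiveOnSmooth (𝕜 : Type*) [RCLike 𝕜] (N : ℕ) (hN : 2 ≤ N) (p q : ℝ[X])
    (t : Fin N → ℝ) (ht : StrictMono t) (hpq : ∀ s : ℝ, ¬ (p.eval s = 0 ∧ q.eval s = 0))
    (hp : ∀ s : ℝ, p.eval s = 0 ↔ ∃ j, s = t j) (hd : ∀ j, p.derivative.eval (t j) ≠ 0)
    (hq : ∀ (j : ℕ) (hj : j + 1 < N),
      {s | s ∈ Ioo (t ⟨j, Nat.lt_of_succ_lt hj⟩) (t ⟨j + 1, hj⟩) ∧ q.eval s = 0}.Subsingleton) :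
    List.TFAE
      [¬ SurjectiveOnSmooth 𝕜 p q,
       ∃ (j : ℕ) (hj : j + 1 < N), IsSeparatrix p q (t ⟨j, Nat.lt_of_succ_lt hj⟩) (t ⟨j + 1, hj⟩),
       ∃ (j : ℕ) (hj : j + 1 < N), ∃ θ ∈ Ioo (t ⟨j, Nat.lt_of_succ_lt hj⟩) (t ⟨j + 1, hj⟩),
         q.eval θ = 0 ∧
           OppositeSigns (fun s => q.eval s) (t ⟨j, Nat.lt_of_succ_lt hj⟩) θ (t ⟨j + 1, hj⟩)] := by
  have hpt : ∀ j, p.eval (t j) = 0 := fun j => (hp _).2 ⟨j, rfl⟩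
  have hqt : ∀ j, q.eval (t j) ≠ 0 := fun j h => hpq _ ⟨hpt j, h⟩
  have hlt : ∀ (j : ℕ) (hj : j + 1 < N), t ⟨j, Nat.lt_of_succ_lt hj⟩ < t ⟨j + 1, hj⟩ :=
    fun j hj => ht (Fin.mk_lt_mk.2 j.lt_succ_self)
  have hne : ∀ (j : ℕ) (hj : j + 1 < N), ∀ s ∈ Ioo (t ⟨j, Nat.lt_of_succ_lt hj⟩) (t ⟨j + 1, hj⟩),
      p.eval s ≠ 0 := by
    intro j hj s hs h0
    obtain ⟨i, rfl⟩ := (hp s).1 h0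
    have h1 := Fin.lt_def.1 (ht.lt_iff_lt.1 hs.1)
    have h2 := Fin.lt_def.1 (ht.lt_iff_lt.1 hs.2)
    simp only at h1 h2
    omega
  tfae_have 2 → 1 := by
    rintro ⟨j, hj, h⟩
    exact not_surjectiveOnSmooth_of_isSeparatrix 𝕜 (hlt j hj) (hpt _) (hpt _) (hne j hj) (hd _)
      (hd _) h
  tfae_have 3 → 2 := by
    rintro ⟨j, hj, θ, hθ, -, h⟩
    exact ⟨j, hj, isSeparatrix_of_mul_neg (hlt j hj) (hpt _) (hpt _) (hne j hj) (hd _) (hd _)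
      (h.mul_neg q.continuous hθ (hqt _) (hqt _))⟩
  tfae_have 1 → 3 := by
    intro hns
    by_contra hno
    -- Without a sign change in any strip, the sign of `q` propagates from `t 0` to every zero of
    -- `p`, and the sign criterion applies.
    have hstep : ∀ (j : ℕ) (hj : j + 1 < N),
        0 < q.eval (t ⟨j, Nat.lt_of_succ_lt hj⟩) * q.eval (t ⟨j + 1, hj⟩) := by
      intro j hj
      by_contra hle
      have hneg := lt_of_le_of_ne (not_lt.1 hle) (mul_ne_zero (hqt _) (hqt _))
      exact hno ⟨j, hj, exists_oppositeSigns_of_mul_neg q.continuous (hlt j hj) hneg (hq j hj)⟩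
    have hall : ∀ (j : ℕ) (hj : j < N),
        0 < q.eval (t ⟨0, by omega⟩) * q.eval (t ⟨j, hj⟩) := by
      intro j
      induction j with
      | zero => exact fun _ => mul_self_pos.2 (hqt _)
      | succ j ih =>
        intro hj
        have h1 := ih (Nat.lt_of_succ_lt hj)
        have h2 := hstep j hj
        rcases pos_and_pos_or_neg_and_neg_of_mul_pos h1 with h | h
        · exact mul_pos h.1 ((pos_iff_pos_of_mul_pos h2).1 h.2)
        · exact mul_pos_of_neg_of_neg h.1 ((neg_iff_neg_of_mul_pos h2).1 h.2)
    refine hns (surjectiveOnSmooth_of_sign 𝕜 ?_)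
    rcases (hqt ⟨0, by omega⟩).lt_or_gt with h0 | h0
    · refine Or.inr fun s hs => ?_
      obtain ⟨j, rfl⟩ := (hp s).1 hs
      exact (neg_iff_neg_of_mul_pos (hall j j.2)).1 h0
    · refine Or.inl fun s hs => ?_
      obtain ⟨j, rfl⟩ := (hp s).1 hs
      exact (pos_iff_pos_of_mul_pos (hall j j.2)).1 h0
  tfae_finish

/-- The values of `q` at the zeros `±1` are `lam` and `lam * (-1) ^ k`, so parity alone decides
whether their signs agree. -/
theorem not_surjectiveOnSmooth_iff_odd (𝕜 : Type*) [RCLike 𝕜] (lam : ℝ) (k : ℕ)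
    (hlam : lam ≠ 0) : ¬ SurjectiveOnSmooth 𝕜 (1 - X ^ 2) (C lam * X ^ k) ↔ Odd k := by
  have hzero : ∀ s : ℝ, (1 - X ^ 2 : ℝ[X]).eval s = 0 ↔ s = -1 ∨ s = 1 := fun s => by
    rw [eval_sub, eval_one, eval_pow, eval_X, sub_eq_zero, eq_comm, sq_eq_one_iff, or_comm]
  have hend : ∀ s : ℝ, (C lam * X ^ k : ℝ[X]).eval s = lam * s ^ k := fun s => by simp
  constructor
  · contrapose!
    intro hk
    rw [Nat.not_odd_iff_even] at hk
    refine surjectiveOnSmooth_of_sign 𝕜 ?_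
    have hval : ∀ s, (1 - X ^ 2 : ℝ[X]).eval s = 0 → (C lam * X ^ k : ℝ[X]).eval s = lam := by
      intro s hs
      rw [hend]
      rcases (hzero s).1 hs with rfl | rfl
      · rw [hk.neg_one_pow, mul_one]
      · rw [one_pow, mul_one]
    rcases hlam.lt_or_gt with h | h
    · exact Or.inr fun s hs => (hval s hs).symm ▸ h
    · exact Or.inl fun s hs => (hval s hs).symm ▸ h
  · intro hk
    have hder : ∀ s : ℝ, (1 - X ^ 2 : ℝ[X]).derivative.eval s = -(2 * s) := fun s => by
      simp [one_add_one_eq_two]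
    have pa : (1 - X ^ 2 : ℝ[X]).eval (-1) = 0 := (hzero _).2 (Or.inl rfl)
    have pb : (1 - X ^ 2 : ℝ[X]).eval 1 = 0 := (hzero _).2 (Or.inr rfl)
    have hne : ∀ s ∈ Ioo (-1 : ℝ) 1, (1 - X ^ 2 : ℝ[X]).eval s ≠ 0 := fun s hs h => by
      rcases (hzero s).1 h with rfl | rfl
      · exact lt_irrefl _ hs.1
      · exact lt_irrefl _ hs.2
    have da : (1 - X ^ 2 : ℝ[X]).derivative.eval (-1) ≠ 0 := by rw [hder]; norm_num
    have db : (1 - X ^ 2 : ℝ[X]).derivative.eval 1 ≠ 0 := by rw [hder]; norm_num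
    refine not_surjectiveOnSmooth_of_isSeparatrix 𝕜 (by norm_num) pa pb hne da db
      (isSeparatrix_of_mul_neg (by norm_num) pa pb hne da db ?_)
    rw [hend, hend, hk.neg_one_pow, one_pow]
    have : 0 < lam * lam := mul_self_pos.2 hlam
    linarith

theorem theorem1p1 (𝕜 : Type*) [RCLike 𝕜] :
    (∀ (N : ℕ) (_ : 2 ≤ N) (p q : ℝ[X]) (t : Fin N → ℝ),
      StrictMono t →
      (∀ s : ℝ, ¬ (p.eval s = 0 ∧ q.eval s = 0)) →
      (∀ s : ℝ, p.eval s = 0 ↔ ∃ j, s = t j) →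
      (∀ j, p.derivative.eval (t j) ≠ 0) →
      (∀ (j : ℕ) (hj : j + 1 < N),
        {s | s ∈ Ioo (t ⟨j, by omega⟩) (t ⟨j + 1, hj⟩) ∧ q.eval s = 0}.Subsingleton) →
      List.TFAE
        [¬ SurjectiveOnSmooth 𝕜 p q,
         ∃ (j : ℕ) (hj : j + 1 < N), IsSeparatrix p q (t ⟨j, by omega⟩) (t ⟨j + 1, hj⟩),
         ∃ (j : ℕ) (hj : j + 1 < N), ∃ θ ∈ Ioo (t ⟨j, by omega⟩) (t ⟨j + 1, hj⟩),
           q.eval θ = 0 ∧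
             OppositeSigns (fun s => q.eval s) (t ⟨j, by omega⟩) θ (t ⟨j + 1, hj⟩)]) ∧
    (∀ (lam : ℝ) (k : ℕ), lam ≠ 0 →
      (¬ SurjectiveOnSmooth 𝕜 (1 - X ^ 2) (C lam * X ^ k) ↔ Odd k)) := by
  exact ⟨tfae_not_surjectiveOnSmooth 𝕜, not_surjectiveOnSmooth_iff_odd 𝕜⟩
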